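/- Let $\mathbb{H}=\{z\in\mathbb{C}:\operatorname{Im}z>0\}$. Let $\mathcal{P}$ be the set of Pick functions, i.e. of all holomorphic $\Phi:\mathbb{C}\setminus\mathbb{R}\to\mathbb{C}$ with $\operatorname{Im}\Phi(z)/\operatorname{Im}z\ge 0$ for $z\in\mathbb{C}\setminus\mathbb{R}$ and $\Phi(z)=\overline{\Phi(\overline{z})}$ for $z\in-\mathbb{H}$. Let $\log\mathcal{P}$ be the set of all functions $\log\Phi$ with $\Phi\in\mathcal{P}\setminus\{0\}$, where the principal logarithm is taken on $\mathbb{H}$ and the function is extended to $-\mathbb{H}$ by $f(z)=\overline{f(\overline z)}$. Let $\mathcal{P}_{\mathrm{int}}$ be the set of all holomorphic $f:\mathbb{C}\setminus\mathbb{R}\to\mathbb{C}$ with $f'\in\mathcal{P}$ and $f(-i)=\overline{f(i)}$. Let $f:\mathbb{C}\setminus\mathbb{R}\to\mathbb{C}$ be a function with $f(z)=\overline{f(\overline z)}$ for all $z\in-\mathbb{H}$. Then the following are equivalent: (a) $f\in\mathcal{P}_{\mathrm{int}}\cap\log\mathcal{P}$, and $f$ extends holomorphically to $(\mathbb{C}\setminus\mathbb{R})\cup(-\infty,1)$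 with value $f(0)=0$ at the origin; (b) there exists a Borel probability measure $\mu$ on $\mathbb{R}$ with $\operatorname{supp}\mu\subseteq[0,1]$ such that $$f(z)=\int_{[0,1]}\log\frac{1}{1-tz}\,d\mu(t),\qquad z\in\mathbb{H},$$ where the principal branch of the logarithm is taken. Moreover, if $f$ has the representation in (b) with such a measure $\mu$ and $f$ is constant on $\mathbb{H}$, then $f\equiv 0$, $\operatorname{supp}\mu=\{0\}$ and $\mu(\{0\})=1$. -/

import Mathlib

open scoped ComplexConjugate

/-- The set `ℂ \ ℝ`. All functions below are functions on `ℂ \ ℝ`, represented by total functions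
`ℂ → ℂ` whose values on the real axis are never used. -/
def offReal : Set ℂ := {z | z.im ≠ 0}

/-- `f (z) = conj (f (conj z))` for `z` in the lower half plane: `f` on the lower half plane is
the reflection of its values on the upper half plane. -/
def ReflectionSymmetric (f : ℂ → ℂ) : Prop :=
  ∀ z : ℂ, z.im < 0 → f z = conj (f (conj z))

/-- The class `𝒫` of Pick functions: holomorphic on `ℂ \ ℝ`, with `Im Φ(z) / Im z ≥ 0` and
symmetric under reflection. -/
def Pick : Set (ℂ → ℂ) :=
  {Φ | DifferentiableOn ℂ Φ offReal ∧ (∀ z ∈ offReal, 0 ≤ (Φ z).im / z.im) ∧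
    ReflectionSymmetric Φ}

/-- The class `log 𝒫` of logarithms of Pick functions that are not identically zero. The logarithm
is the principal one on the upper half plane, where the argument of `Φ` lies in `[0, π]`; the values
on the lower half plane are obtained by reflection. -/
def LogPick : Set (ℂ → ℂ) :=
  {f | ReflectionSymmetric f ∧ ∃ Φ ∈ Pick, (∃ z ∈ offReal, Φ z ≠ 0) ∧
    ∀ z : ℂ, 0 < z.im → f z = Complex.log (Φ z)}

/-- The class of primitives of Pick functions: `f` holomorphic on `ℂ \ ℝ` with `f' ∈ 𝒫` and
`f (-i) = conj (f (i))`. -/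
def PrimPick : Set (ℂ → ℂ) :=
  {f | DifferentiableOn ℂ f offReal ∧ deriv f ∈ Pick ∧
    f (-Complex.I) = conj (f Complex.I)}

/-- `F` is a holomorphic extension of `f` (given on `ℂ \ ℝ`) across the subset `I` of the real
axis: `F` is holomorphic at all points of `(ℂ \ ℝ) ∪ I` and equals `f` on `ℂ \ ℝ`. -/
def IsHolExtension (f : ℂ → ℂ) (I : Set ℝ) (F : ℂ → ℂ) : Prop :=
  AnalyticOnNhd ℂ F (offReal ∪ Complex.ofReal '' I) ∧ Set.EqOn F f offReal

/-- `f (z) = ∫_{[0,1]} log (1 / (1 - t z)) dμ(t)` for all `z` in the upper half plane, with the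
principal branch of the logarithm. -/
def HasLogRepresentation (f : ℂ → ℂ) (μ : MeasureTheory.Measure ℝ) : Prop :=
  ∀ z : ℂ, 0 < z.im → f z = ∫ t in Set.Icc (0 : ℝ) 1, Complex.log (1 / (1 - (t : ℂ) * z)) ∂μ

open MeasureTheory Set Topology Filter

/-! The analytic core is a Stieltjes formula. A Pick function `g` holomorphic off `[1, ∞)` satisfies
`g z = g 0 + z ∫ (1 - t z)⁻¹ dσ(t)` with `σ` finite on `[0, 1]` (`exists_measure_stieltjes`). It
follows by pulling `g` back to the disk along the Koebe function and applying Herglotz to the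
resulting typically real function.

For (a) ⇒ (b), take `g = F'`. Membership in `LogPick` bounds `Im F` between `0` and `π`, so
integrating `Im F'` along `Im z = 1` gives at most `π`. Tonelli turns this into `∫ t⁻² dσ ≤ 1`
(`lintegral_inv_sq_le_one`). Hence `t⁻² σ` has mass at most one; an atom at `0`, which the
logarithmic kernel does not see, completes it to a probability measure. The potential of this
measure differs from `F` by a linear function, which is zero because both imaginary parts are
bounded.

For (b) ⇒ (a), differentiation under the integral gives the Pick property of `f'`, and `exp f` is a
Pick function because averages of arguments in `[0, π]` stay in `[0, π]`. In the constant case, the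
value is the limit `0` at the origin, and a nonnegative integrand with zero integral at `z = i`
forces `t = 0` almost everywhere. -/

/-! ### The slit plane and the logarithmic kernel -/

/-- The slit plane `ℂ \ [1, ∞)`. -/
def slitAtOne : Set ℂ := offReal ∪ Complex.ofReal '' Iio 1

lemma mem_slitAtOne {z : ℂ} : z ∈ slitAtOne ↔ z.im ≠ 0 ∨ z.re < 1 := by
  constructor
  · rintro (h | ⟨x, hx, rfl⟩)
    · exact Or.inl h
    · exact Or.inr (by simpa using hx)
  · intro h
    by_cases h0 : z.im = 0
    · refine Or.inr ⟨z.re, h.resolve_left (not_not.2 h0), ?_⟩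
      apply Complex.ext <;> simp [h0]
    · exact Or.inl h0

lemma isOpen_offReal : IsOpen offReal :=
  isOpen_ne_fun Complex.continuous_im continuous_const

lemma isOpen_slitAtOne : IsOpen slitAtOne := by
  have : slitAtOne = {z : ℂ | z.im ≠ 0} ∪ {z : ℂ | z.re < 1} := by
    ext z; exact mem_slitAtOne
  rw [this]
  exact isOpen_offReal.union (isOpen_lt Complex.continuous_re continuous_const)

lemma offReal_subset_slitAtOne : offReal ⊆ slitAtOne := subset_union_left

lemma zero_mem_slitAtOne : (0 : ℂ) ∈ slitAtOne := mem_slitAtOne.2 (by simp)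

lemma starConvex_slitAtOne : StarConvex ℝ 0 slitAtOne := by
  rw [starConvex_zero_iff]
  intro z hz a ha0 ha1
  rw [mem_slitAtOne] at *
  simp only [Complex.real_smul, Complex.mul_im, Complex.ofReal_re, Complex.ofReal_im,
    Complex.mul_re, zero_mul, add_zero, sub_zero]
  rcases ha0.eq_or_lt with rfl | ha
  · right; simp
  rcases hz with h | h
  · left; positivity
  · right; nlinarith

lemma isPreconnected_slitAtOne : IsPreconnected slitAtOne :=
  (starConvex_slitAtOne.isPathConnected zero_mem_slitAtOne).isConnected.isPreconnected

lemma one_sub_mul_mem_slitPlane {t : ℝ} (ht : t ∈ Icc (0 : ℝ) 1) {z : ℂ} (hz : z ∈ slitAtOne) :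
    1 - (t : ℂ) * z ∈ Complex.slitPlane := by
  rw [Complex.mem_slitPlane_iff]
  rw [mem_slitAtOne] at hz
  simp only [Complex.sub_re, Complex.one_re, Complex.mul_re, Complex.ofReal_re, Complex.ofReal_im,
    zero_mul, sub_zero, Complex.sub_im, Complex.one_im, Complex.mul_im, add_zero, zero_sub]
  rcases ht.1.eq_or_lt with h0 | h0
  · left; simp [← h0]
  rcases hz with h | h
  · right; exact neg_ne_zero.2 (mul_ne_zero h0.ne' h)
  · left; nlinarith [ht.2]

lemma one_sub_mul_ne_zero {t : ℝ} (ht : t ∈ Icc (0 : ℝ) 1) {z : ℂ} (hz : z ∈ slitAtOne) :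
    1 - (t : ℂ) * z ≠ 0 := Complex.slitPlane_ne_zero (one_sub_mul_mem_slitPlane ht hz)

lemma log_one_div_one_sub {t : ℝ} (ht : t ∈ Icc (0 : ℝ) 1) {z : ℂ} (hz : z ∈ slitAtOne) :
    Complex.log (1 / (1 - (t : ℂ) * z)) = -Complex.log (1 - (t : ℂ) * z) := by
  rw [one_div, Complex.log_inv _ (Complex.slitPlane_arg_ne_pi (one_sub_mul_mem_slitPlane ht hz))]

lemma continuousOn_log_one_div_one_sub {z : ℂ} (hz : z ∈ slitAtOne) :
    ContinuousOn (fun t : ℝ ↦ Complex.log (1 / (1 - (t : ℂ) * z))) (Icc 0 1) := by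
  refine ContinuousOn.congr (f := fun t : ℝ ↦ -Complex.log (1 - (t : ℂ) * z)) ?_
    (fun t ht ↦ log_one_div_one_sub ht hz)
  exact (ContinuousOn.clog (by fun_prop) fun t ht ↦ one_sub_mul_mem_slitPlane ht hz).neg

/-! ### Holomorphy of the integral transforms -/

/-- Differentiation under the integral sign over a compact parameter set, with a derivative that
is jointly continuous. -/
lemma hasDerivAt_setIntegral_of_continuousOn {μ : Measure ℝ} [IsFiniteMeasure μ] {I : Set ℝ}
    (hI : IsCompact I) {U : Set ℂ} (hU : IsOpen U) {K K' : ℝ → ℂ → ℂ}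
    (hK : ∀ z ∈ U, ContinuousOn (fun t ↦ K t z) I)
    (hd : ∀ t ∈ I, ∀ z ∈ U, HasDerivAt (K t) (K' t z) z)
    (hK' : ContinuousOn (fun p : ℝ × ℂ ↦ K' p.1 p.2) (I ×ˢ U)) {z : ℂ} (hz : z ∈ U) :
    HasDerivAt (fun z ↦ ∫ t in I, K t z ∂μ) (∫ t in I, K' t z ∂μ) z := by
  obtain ⟨ε, hε, hεU⟩ := Metric.nhds_basis_closedBall.mem_iff.1 (hU.mem_nhds hz)
  obtain ⟨C, hC⟩ := (hI.prod (isCompact_closedBall z ε)).exists_bound_of_continuousOn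
    (hK'.mono (prod_mono le_rfl hεU))
  have hcont (w : ℂ) (hw : w ∈ U) : ContinuousOn (fun t ↦ K' t w) I :=
    hK'.comp (f := fun t : ℝ ↦ (t, w)) (by fun_prop) (fun t ht ↦ ⟨ht, hw⟩)
  refine (hasDerivAt_integral_of_dominated_loc_of_deriv_le (F := fun z t ↦ K t z)
    (F' := fun z t ↦ K' t z) (bound := fun _ ↦ C)
    (Metric.closedBall_mem_nhds z hε) ?_ ?_ ?_ ?_ ?_ ?_).2
  · filter_upwards [hU.mem_nhds hz] with w hw
    exact (hK w hw).aestronglyMeasurable hI.measurableSet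
  · exact (hK z hz).integrableOn_compact hI
  · exact (hcont z hz).aestronglyMeasurable hI.measurableSet
  · filter_upwards [ae_restrict_mem hI.measurableSet] with t ht w hw
    exact hC (t, w) ⟨ht, hw⟩
  · exact integrable_const _
  · filter_upwards [ae_restrict_mem hI.measurableSet] with t ht w hw
    exact hd t ht w (hεU hw)

/-- The logarithmic potential `z ↦ ∫ log (1 / (1 - t z)) dμ(t)` over `[0, 1]`. -/
noncomputable def logPotential (μ : Measure ℝ) (z : ℂ) : ℂ :=
  ∫ t in Icc (0 : ℝ) 1, Complex.log (1 / (1 - (t : ℂ) * z)) ∂μ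

lemma continuousOn_one_sub_mul_inv :
    ContinuousOn (fun p : ℝ × ℂ ↦ (1 - (p.1 : ℂ) * p.2)⁻¹) (Icc (0 : ℝ) 1 ×ˢ slitAtOne) :=
  ContinuousOn.inv₀ (by fun_prop) fun p hp ↦ one_sub_mul_ne_zero hp.1 hp.2

lemma hasDerivAt_logPotential (μ : Measure ℝ) [IsFiniteMeasure μ] {z : ℂ} (hz : z ∈ slitAtOne) :
    HasDerivAt (logPotential μ) (∫ t in Icc (0 : ℝ) 1, (t : ℂ) * (1 - (t : ℂ) * z)⁻¹ ∂μ) z := by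
  refine hasDerivAt_setIntegral_of_continuousOn (K' := fun t z ↦ (t : ℂ) * (1 - (t : ℂ) * z)⁻¹)
    isCompact_Icc isOpen_slitAtOne ?_ ?_ ?_ hz
  · exact fun w hw ↦ continuousOn_log_one_div_one_sub hw
  · intro t ht w hw
    have h1 : HasDerivAt (fun w : ℂ ↦ -Complex.log (1 - (t : ℂ) * w))
        ((t : ℂ) * (1 - (t : ℂ) * w)⁻¹) w := by
      have := ((((hasDerivAt_id w).const_mul (t : ℂ)).const_sub 1).clog
        (one_sub_mul_mem_slitPlane ht hw)).neg
      convert! this using 1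
      simp [div_eq_mul_inv]
    refine h1.congr_of_eventuallyEq ?_
    filter_upwards [isOpen_slitAtOne.mem_nhds hw] with v hv using log_one_div_one_sub ht hv
  · exact ContinuousOn.mul (by fun_prop) continuousOn_one_sub_mul_inv

lemma analyticOnNhd_logPotential (μ : Measure ℝ) [IsFiniteMeasure μ] :
    AnalyticOnNhd ℂ (logPotential μ) slitAtOne :=
  DifferentiableOn.analyticOnNhd
    (fun _ hz ↦ (hasDerivAt_logPotential μ hz).differentiableAt.differentiableWithinAt)
    isOpen_slitAtOne

lemma logPotential_zero (μ : Measure ℝ) : logPotential μ 0 = 0 := by simp [logPotential]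

lemma analyticOnNhd_integral_one_sub_mul_inv (σ : Measure ℝ) [IsFiniteMeasure σ] :
    AnalyticOnNhd ℂ (fun z ↦ ∫ t in Icc (0 : ℝ) 1, (1 - (t : ℂ) * z)⁻¹ ∂σ) slitAtOne := by
  refine DifferentiableOn.analyticOnNhd (fun z hz ↦ ?_) isOpen_slitAtOne
  refine (hasDerivAt_setIntegral_of_continuousOn
    (K' := fun t z ↦ (t : ℂ) * (1 - (t : ℂ) * z)⁻¹ ^ 2)
    isCompact_Icc isOpen_slitAtOne ?_ ?_ ?_ hz).differentiableAt.differentiableWithinAt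
  · intro w hw
    exact ContinuousOn.inv₀ (by fun_prop) fun t ht ↦ one_sub_mul_ne_zero ht hw
  · intro t ht w hw
    have := (((hasDerivAt_id w).const_mul (t : ℂ)).const_sub 1).inv (one_sub_mul_ne_zero ht hw)
    convert! this using 1
    simp [div_eq_mul_inv]
  · exact ContinuousOn.mul (by fun_prop) (continuousOn_one_sub_mul_inv.pow 2)

/-! ### Herglotz representation on the disk -/

/-- The parametrization `θ ↦ (1 + cos θ) / 2` of `[0, 1]`. -/
noncomputable def cosParam (θ : ℝ) : Icc (0 : ℝ) 1 :=
  ⟨(1 + Real.cos θ) / 2, by constructor <;> linarith [Real.neg_one_le_cos θ, Real.cos_le_one θ]⟩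

lemma continuous_cosParam : Continuous cosParam := by
  unfold cosParam; fun_prop

/-- At a real point the denominator `|e^{iθ} - x|² = 1 + x² - 2 x cos θ` depends on `θ` only through
`cos θ`, so Poisson integrals can be pushed forward to `[0, 1]`. -/
lemma poissonKernel_circleMap_ofReal (x θ : ℝ) :
    poissonKernel 0 (x : ℂ) (circleMap 0 1 θ) =
      (1 - x ^ 2) * ((1 + x) ^ 2 - 4 * x * (cosParam θ : ℝ))⁻¹ := by
  rw [poissonKernel_def]
  simp only [sub_zero, norm_circleMap_zero, abs_one, one_pow, Complex.norm_real, Real.norm_eq_abs,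
    sq_abs, div_eq_mul_inv]
  congr 2
  rw [← Complex.normSq_eq_norm_sq, Complex.normSq_apply]
  simp only [circleMap, cosParam, Complex.ofReal_one, one_mul, zero_add, Complex.sub_re,
    Complex.exp_ofReal_mul_I_re, Complex.exp_ofReal_mul_I_im, Complex.sub_im, Complex.ofReal_re,
    Complex.ofReal_im, sub_zero]
  linarith [Real.sin_sq_add_cos_sq θ]

lemma continuous_comp_mul_circleMap {q : ℂ → ℂ} (hq : DifferentiableOn ℂ q (Metric.ball 0 1))
    {r : ℝ} (hr0 : 0 < r) (hr1 : r < 1) :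
    Continuous fun θ ↦ (1 - (circleMap 0 1 θ) ^ 2) * q (r * circleMap 0 1 θ) := by
  have h1 : Continuous fun θ ↦ q (r * circleMap 0 1 θ) := by
    refine hq.continuousOn.comp_continuous (by fun_prop) fun θ ↦ ?_
    simpa [abs_of_pos hr0] using hr1
  exact (continuous_const.sub ((continuous_circleMap 0 1).pow 2)).mul h1

lemma inv_kernel_pos {x : ℝ} (hx : x ∈ Ioo (-1 : ℝ) 1) (t : Icc (0 : ℝ) 1) :
    0 < (1 + x) ^ 2 - 4 * x * (t : ℝ) := by
  have h0 := t.2.1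
  have h1 := t.2.2
  have : (1 + x) ^ 2 - 4 * x * (t : ℝ) = (1 - t) * (1 + x) ^ 2 + t * (1 - x) ^ 2 := by ring
  rw [this]
  have a := sq_pos_of_pos (show 0 < 1 + x by linarith [hx.1])
  have b := sq_pos_of_pos (show 0 < 1 - x by linarith [hx.2])
  rcases h0.eq_or_lt with h | h
  · rw [← h]; simpa
  · have := mul_pos h b
    nlinarith [mul_nonneg (sub_nonneg.2 h1) a.le]

/-- Poisson's formula for `w ↦ (1 - w²) q (r w)` at real points, as an integral over `[0, 1]`. -/
lemma exists_finiteMeasure_integral_eq_of_re_nonneg {q : ℂ → ℂ}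
    (hq : DifferentiableOn ℂ q (Metric.ball 0 1)) {r : ℝ} (hr0 : 0 < r) (hr1 : r < 1)
    (hpos : ∀ w : ℂ, ‖w‖ = 1 → 0 ≤ ((1 - w ^ 2) * q (r * w)).re) :
    ∃ ρ : FiniteMeasure (Icc (0 : ℝ) 1), ∀ x ∈ Ioo (-1 : ℝ) 1,
      ∫ t, ((1 + x) ^ 2 - 4 * x * (t : ℝ))⁻¹ ∂(ρ : Measure (Icc (0 : ℝ) 1)) = (q (r * x)).re := by
  set D : ℝ → ℝ := fun θ ↦ ((1 - (circleMap 0 1 θ) ^ 2) * q (r * circleMap 0 1 θ)).re with hD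
  have hDc : Continuous D :=
    Complex.continuous_re.comp (continuous_comp_mul_circleMap hq hr0 hr1)
  have hD0 (θ : ℝ) : 0 ≤ D θ := hpos _ (by simp)
  set ν : Measure ℝ := (volume.restrict (Ioc 0 (2 * Real.pi))).withDensity
    fun θ ↦ ((D θ / (2 * Real.pi)).toNNReal : ENNReal) with hν
  have hDi : IntegrableOn (fun θ ↦ D θ / (2 * Real.pi)) (Ioc 0 (2 * Real.pi)) :=
    ((hDc.div_const _).integrableOn_Icc).mono_set Ioc_subset_Icc_self
  have : IsFiniteMeasure ν := isFiniteMeasure_withDensity_ofReal hDi.2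
  refine ⟨⟨ν.map cosParam, inferInstance⟩, fun x hx ↦ ?_⟩
  have hx2 : 0 < 1 - x ^ 2 := by nlinarith [hx.1, hx.2]
  have hmeas : Measurable fun t : Icc (0 : ℝ) 1 ↦ ((1 + x) ^ 2 - 4 * x * (t : ℝ))⁻¹ := by fun_prop
  rw [FiniteMeasure.toMeasure_mk, integral_map continuous_cosParam.aemeasurable
    hmeas.aestronglyMeasurable, integral_withDensity_eq_integral_smul (by fun_prop)]
  have hQ : DifferentiableOn ℂ (fun w : ℂ ↦ (1 - w ^ 2) * q (r * w))
      (closure (Metric.ball 0 1)) := by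
    rw [closure_ball _ one_ne_zero]
    refine DifferentiableOn.mul (by fun_prop) (hq.comp (by fun_prop) fun w hw ↦ ?_)
    simp only [Metric.mem_closedBall, dist_zero_right] at hw
    simp only [Metric.mem_ball, dist_zero_right, norm_mul, Complex.norm_real, Real.norm_eq_abs,
      abs_of_pos hr0]
    nlinarith [norm_nonneg w]
  have hxb : (x : ℂ) ∈ Metric.ball (0 : ℂ) 1 := by
    simpa [abs_lt] using hx
  have hP := hQ.diffContOnCl.circleAverage_poissonKernel_smul hxb
  have hP2 := congrArg Complex.re hP
  rw [Real.circleAverage_def, intervalIntegral.integral_of_le Real.two_pi_pos.le] at hP2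
  have hint : Integrable (fun θ ↦ (poissonKernel 0 (x : ℂ) • fun w : ℂ ↦ (1 - w ^ 2) * q (r * w))
      (circleMap 0 1 θ)) (volume.restrict (Ioc 0 (2 * Real.pi))) := by
    have hc : Continuous fun θ ↦
        (poissonKernel 0 (x : ℂ) • fun w : ℂ ↦ (1 - w ^ 2) * q (r * w)) (circleMap 0 1 θ) := by
      simp only [Pi.smul_apply', poissonKernel_circleMap_ofReal]
      refine Continuous.smul (continuous_const.mul (Continuous.inv₀ ?_ fun θ ↦
        (inv_kernel_pos hx _).ne')) (continuous_comp_mul_circleMap hq hr0 hr1)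
      exact continuous_const.sub
        (continuous_const.mul (continuous_subtype_val.comp continuous_cosParam))
    exact hc.integrableOn_Icc.mono_set Ioc_subset_Icc_self
  have hre : ((1 - (x : ℂ) ^ 2) * q (r * x)).re = (1 - x ^ 2) * (q (r * x)).re := by
    have : (1 - (x : ℂ) ^ 2) = ((1 - x ^ 2 : ℝ) : ℂ) := by push_cast; rfl
    rw [this, Complex.re_ofReal_mul]
  rw [hre, Complex.smul_re, ← Complex.reCLM_apply, ← ContinuousLinearMap.integral_comp_comm _ hint,
    smul_eq_mul, ← integral_const_mul] at hP2
  -- The numerator `1 - x²` of the Poisson kernel cancels the factor `1 - w²` at `w = x`.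
  refine mul_left_cancel₀ hx2.ne' (Eq.trans ?_ hP2)
  rw [← integral_const_mul]
  congr 1 with θ
  rw [Pi.smul_apply', poissonKernel_circleMap_ofReal, Complex.reCLM_apply, Complex.smul_re,
    NNReal.smul_def, Real.coe_toNNReal _ (div_nonneg (hD0 θ) Real.two_pi_pos.le)]
  simp only [hD, smul_eq_mul]
  ring

/-- **Herglotz representation** of typically real functions on the unit disk, at real points. -/
lemma exists_measure_integral_eq_dslope {G : ℂ → ℂ}
    (hG : DifferentiableOn ℂ G (Metric.ball 0 1)) (h0 : (G 0).im = 0)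
    (hs : ∀ w ∈ Metric.ball (0 : ℂ) 1, 0 ≤ w.im * (G w).im) :
    ∃ σ : FiniteMeasure (Icc (0 : ℝ) 1), ∀ x ∈ Ioo (-1 : ℝ) 1,
      ∫ t, ((1 + x) ^ 2 - 4 * x * (t : ℝ))⁻¹ ∂(σ : Measure (Icc (0 : ℝ) 1)) =
        (dslope G 0 x).re := by
  set q := dslope G 0 with hqdef
  have hq : DifferentiableOn ℂ q (Metric.ball 0 1) :=
    (Complex.differentiableOn_dslope (Metric.ball_mem_nhds _ one_pos)).2 hG
  have hpos (r : ℝ) (hr : r ∈ Ioo (0 : ℝ) 1) (w : ℂ) (hw : ‖w‖ = 1) :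
      0 ≤ ((1 - w ^ 2) * q (r * w)).re := by
    have hw0 : w ≠ 0 := by rintro rfl; simp at hw
    have hr0 : (r : ℂ) ≠ 0 := by exact_mod_cast hr.1.ne'
    have hww : w * conj w = 1 := by rw [Complex.mul_conj, Complex.normSq_eq_norm_sq, hw]; simp
    -- On the unit circle `1 - w² = w (conj w - w)`; the factor `w` cancels the denominator of the
    -- slope, and `conj w - w` is purely imaginary, so the real part sees only `w.im * (G (r
    -- w)).im`.
    have h1 : (1 - w ^ 2) * q (r * w) = (r⁻¹ : ℝ) * ((conj w - w) * (G (r * w) - G 0)) := by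
      rw [hqdef, dslope_of_ne _ (mul_ne_zero hr0 hw0), slope_def_field, sub_zero]
      push_cast
      have : (1 - w ^ 2) = w * (conj w - w) := by rw [mul_sub, hww]; ring
      rw [this]; field_simp
    have hb : (r : ℂ) * w ∈ Metric.ball (0 : ℂ) 1 := by
      simpa [hw, abs_of_pos hr.1] using hr.2
    have h2 := hs _ hb
    simp only [Complex.mul_im, Complex.ofReal_re, Complex.ofReal_im, zero_mul, add_zero] at h2
    have h3 : 0 ≤ w.im * (G (r * w)).im := by
      rw [mul_assoc] at h2; exact nonneg_of_mul_nonneg_right h2 hr.1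
    rw [h1, Complex.re_ofReal_mul]
    refine mul_nonneg (inv_nonneg.2 hr.1.le) ?_
    simp only [Complex.mul_re, Complex.sub_re, Complex.conj_re, sub_self, zero_mul,
      Complex.sub_im, Complex.conj_im, h0, sub_zero]
    linarith
  have hex (r : ℝ) : ∃ ρ : FiniteMeasure (Icc (0 : ℝ) 1), r ∈ Ioo (0 : ℝ) 1 →
      ∀ x ∈ Ioo (-1 : ℝ) 1, ∫ t, ((1 + x) ^ 2 - 4 * x * (t : ℝ))⁻¹
        ∂(ρ : Measure (Icc (0 : ℝ) 1)) = (q (r * x)).re := by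
    by_cases hr : r ∈ Ioo (0 : ℝ) 1
    · obtain ⟨ρ, hρ⟩ := exists_finiteMeasure_integral_eq_of_re_nonneg hq hr.1 hr.2 (hpos r hr)
      exact ⟨ρ, fun _ ↦ hρ⟩
    · exact ⟨0, fun h ↦ absurd h hr⟩
  choose ρ hρ using hex
  have hev : ∀ᶠ r in 𝓝[<] (1 : ℝ), r ∈ Ioo (0 : ℝ) 1 := Ioo_mem_nhdsLT one_pos
  -- At `x = 0` the kernel is `1`, so every `ρ r` has mass `(q 0).re`; weak compactness then yields
  -- a cluster point as `r → 1`.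
  have hmass : map ρ (𝓝[<] (1 : ℝ)) ≤ 𝓟 {μ | μ.mass ≤ (q 0).re.toNNReal} := by
    rw [le_principal_iff, mem_map]
    filter_upwards [hev] with r hr
    have := hρ r hr 0 (by norm_num)
    simp only [Complex.ofReal_zero, mul_zero, zero_mul, sub_zero, add_zero, one_pow, inv_one,
      integral_const, smul_eq_mul, mul_one] at this
    rw [mem_preimage, mem_ofPred_eq, ← this]
    apply le_of_eq
    rw [measureReal_def, ENNReal.toReal, Real.toNNReal_coe]
    rfl
  obtain ⟨σ, -, hσ⟩ := (isCompact_setOfPred_finiteMeasure_le_of_compactSpace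
    (Icc (0 : ℝ) 1) (q 0).re.toNNReal).exists_mapClusterPt hmass
  refine ⟨σ, fun x hx ↦ ?_⟩
  let k : C(Icc (0 : ℝ) 1, ℝ) := ⟨fun t ↦ ((1 + x) ^ 2 - 4 * x * (t : ℝ))⁻¹,
    Continuous.inv₀ (by fun_prop) fun t ↦ (inv_kernel_pos hx t).ne'⟩
  have hcl := hσ.continuousAt_comp (FiniteMeasure.continuous_integral_continuousMap k).continuousAt
  have hlim : Tendsto (fun r : ℝ ↦ (q (r * x)).re) (𝓝[<] (1 : ℝ)) (𝓝 (q x).re) := by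
    have hxb : (x : ℂ) ∈ Metric.ball (0 : ℂ) 1 := by simpa [abs_lt] using hx
    have hc : ContinuousAt q ((1 : ℝ) * x) := by
      simpa using (hq.differentiableAt (Metric.isOpen_ball.mem_nhds hxb)).continuousAt
    have : ContinuousAt (fun r : ℝ ↦ (q (r * x)).re) 1 :=
      Complex.continuous_re.continuousAt.comp
        (ContinuousAt.comp (f := fun r : ℝ ↦ (r : ℂ) * x) hc (by fun_prop))
    simpa using this.tendsto.mono_left nhdsWithin_le_nhds
  have hlim2 : Tendsto ((fun μ : FiniteMeasure (Icc (0 : ℝ) 1) ↦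
      ∫ t, k t ∂(μ : Measure (Icc (0 : ℝ) 1))) ∘ ρ) (𝓝[<] (1 : ℝ)) (𝓝 (q x).re) := by
    refine hlim.congr' ?_
    filter_upwards [hev] with r hr using (hρ r hr x hx).symm
  have hne := hcl.clusterPt.mono hlim2
  exact eq_of_nhds_neBot hne

/-! ### The Koebe function and the Stieltjes representation -/

/-- The Koebe function `w ↦ 4 w / (1 + w)²`, mapping the unit disk to `ℂ \ [1, ∞)`. -/
noncomputable def koebe (w : ℂ) : ℂ := 4 * w / (1 + w) ^ 2

lemma one_add_ne_zero_of_mem_ball {w : ℂ} (hw : w ∈ Metric.ball (0 : ℂ) 1) : 1 + w ≠ 0 := by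
  intro h
  have : w = -1 := by linear_combination h
  simp [this] at hw

lemma im_koebe (w : ℂ) :
    (koebe w).im = w.im * (4 * (1 - Complex.normSq w) / Complex.normSq (1 + w) ^ 2) := by
  have h : koebe w = 4 * w * conj ((1 + w) ^ 2) * ((Complex.normSq (1 + w) ^ 2)⁻¹ : ℝ) := by
    rw [koebe, div_eq_mul_inv, Complex.inv_def, map_pow Complex.normSq]
    ring
  rw [h, Complex.im_mul_ofReal, mul_div_assoc', div_eq_mul_inv]
  congr 1
  simp [Complex.normSq_apply, pow_two, Complex.mul_im, Complex.mul_re]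
  ring

lemma koebe_mem_slitAtOne {w : ℂ} (hw : w ∈ Metric.ball (0 : ℂ) 1) : koebe w ∈ slitAtOne := by
  have hn : 0 < 1 - Complex.normSq w := by
    rw [Complex.normSq_eq_norm_sq]
    have : ‖w‖ < 1 := by simpa using hw
    nlinarith [norm_nonneg w]
  have hd : 0 < Complex.normSq (1 + w) := Complex.normSq_pos.2 (one_add_ne_zero_of_mem_ball hw)
  rw [mem_slitAtOne]
  by_cases h : w.im = 0
  · right
    obtain ⟨x, rfl⟩ : ∃ x : ℝ, w = x := ⟨w.re, Complex.ext (by simp) (by simp [h])⟩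
    have hx : |x| < 1 := by simpa using hw
    have hk : koebe x = ((4 * x / (1 + x) ^ 2 : ℝ) : ℂ) := by simp [koebe]
    rw [hk, Complex.ofReal_re, div_lt_one (pow_pos (by linarith [neg_abs_le x]) 2)]
    nlinarith [sq_pos_of_pos (show 0 < 1 - x by linarith [le_abs_self x])]
  · left
    rw [im_koebe]
    positivity

lemma differentiableOn_koebe : DifferentiableOn ℂ koebe (Metric.ball 0 1) := fun w hw ↦ by
  have := one_add_ne_zero_of_mem_ball hw
  unfold koebe
  exact (DifferentiableAt.div (c := fun w : ℂ ↦ 4 * w) (d := fun w ↦ (1 + w) ^ 2) (by fun_prop)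
    (by fun_prop) (pow_ne_zero 2 this)).differentiableWithinAt

/-- The imaginary part is a limit of nonnegative values from above and of nonpositive values from
below. -/
lemma im_eq_zero_of_im_mul_nonneg {g : ℂ → ℂ} (hg : ∀ z ∈ offReal, 0 ≤ z.im * (g z).im) {x : ℝ}
    (hc : ContinuousAt g x) : (g x).im = 0 := by
  have ht : Tendsto (fun y : ℝ ↦ (g (x + y * Complex.I)).im) (𝓝 0) (𝓝 (g x).im) := by
    have : ContinuousAt (fun y : ℝ ↦ (g (x + y * Complex.I)).im) 0 :=
      Complex.continuous_im.continuousAt.comp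
        (ContinuousAt.comp (f := fun y : ℝ ↦ (x + y * Complex.I : ℂ)) (by simpa using hc)
          (by fun_prop))
    simpa using this.tendsto
  apply le_antisymm
  · refine le_of_tendsto (ht.mono_left (nhdsWithin_le_nhds (s := Iio 0))) ?_
    filter_upwards [self_mem_nhdsWithin] with y (hy : y < 0)
    have := hg (x + y * Complex.I) (by simp [offReal, hy.ne])
    simp only [Complex.add_im, Complex.ofReal_im, Complex.mul_im, Complex.ofReal_re,
      Complex.I_im, mul_one, Complex.I_re, mul_zero, add_zero, zero_add] at this
    exact nonpos_of_mul_nonneg_right this hy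
  · refine ge_of_tendsto (ht.mono_left (nhdsWithin_le_nhds (s := Ioi 0))) ?_
    filter_upwards [self_mem_nhdsWithin] with y (hy : 0 < y)
    have := hg (x + y * Complex.I) (by simp [offReal, hy.ne'])
    simp only [Complex.add_im, Complex.ofReal_im, Complex.mul_im, Complex.ofReal_re,
      Complex.I_im, mul_one, Complex.I_re, mul_zero, add_zero, zero_add] at this
    exact nonneg_of_mul_nonneg_right this hy

/-- **Stieltjes representation** of Pick functions that are holomorphic off `[1, ∞)`. -/
lemma exists_measure_stieltjes {g : ℂ → ℂ} (hga : AnalyticOnNhd ℂ g slitAtOne)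
    (hg : ∀ z ∈ offReal, 0 ≤ z.im * (g z).im) :
    ∃ σ : Measure ℝ, IsFiniteMeasure σ ∧
      ∀ z ∈ slitAtOne, g z = g 0 + z * ∫ t in Icc (0 : ℝ) 1, (1 - (t : ℂ) * z)⁻¹ ∂σ := by
  have him (x : ℝ) (hx : x < 1) : (g x).im = 0 :=
    im_eq_zero_of_im_mul_nonneg hg (hga x (mem_slitAtOne.2 (Or.inr (by simpa)))).continuousAt
  have hk0 : koebe 0 = 0 := by simp [koebe]
  have hG : DifferentiableOn ℂ (g ∘ koebe) (Metric.ball 0 1) :=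
    hga.differentiableOn.comp differentiableOn_koebe fun w hw ↦ koebe_mem_slitAtOne hw
  obtain ⟨σ', hσ'⟩ := exists_measure_integral_eq_dslope hG
    (by simpa [hk0] using him 0 one_pos) (by
      intro w hw
      by_cases h : w.im = 0
      · simp [h]
      have hn : 0 < 1 - Complex.normSq w := by
        rw [Complex.normSq_eq_norm_sq]
        have : ‖w‖ < 1 := by simpa using hw
        nlinarith [norm_nonneg w]
      have hd : 0 < Complex.normSq (1 + w) :=
        Complex.normSq_pos.2 (one_add_ne_zero_of_mem_ball hw)
      have hp : 0 < 4 * (1 - Complex.normSq w) / Complex.normSq (1 + w) ^ 2 := by positivity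
      have h2 := hg (koebe w) (by
        change (koebe w).im ≠ 0
        rw [im_koebe]; positivity)
      rw [im_koebe, mul_right_comm] at h2
      exact nonneg_of_mul_nonneg_left h2 hp)
  -- With `y = 4x / (1 + x)²` one has `(1 + x)² - 4xt = (1 + x)² (1 - ty)` and `x = y (1 + x)² / 4`,
  -- whence the factor `1/4`.
  set σ : Measure ℝ := (4⁻¹ : NNReal) • (σ' : Measure (Icc (0 : ℝ) 1)).map Subtype.val with hσ
  have hres : σ.restrict (Icc 0 1) = σ := by
    refine Measure.restrict_eq_self_of_ae_mem ?_
    rw [hσ]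
    refine Measure.ae_smul_measure ?_ _
    exact (ae_map_iff (p := fun t ↦ t ∈ Icc (0 : ℝ) 1) measurable_subtype_coe.aemeasurable
      measurableSet_Icc).2 (ae_of_all _ fun t ↦ t.2)
  refine ⟨σ, inferInstance, ?_⟩
  -- By the identity theorem it is enough to check the points `koebe x` for small `x > 0`, where all
  -- quantities are real.
  refine AnalyticOnNhd.eqOn_of_preconnected_of_frequently_eq (z₀ := 0) hga ?_
    isPreconnected_slitAtOne zero_mem_slitAtOne ?_
  · exact analyticOnNhd_const.add (analyticOnNhd_id.mul (analyticOnNhd_integral_one_sub_mul_inv σ))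
  have hT : Tendsto (fun x : ℝ ↦ koebe x) (𝓝[>] 0) (𝓝[≠] 0) := by
    rw [tendsto_nhdsWithin_iff]
    constructor
    · have : ContinuousAt (fun x : ℝ ↦ koebe x) 0 :=
        ContinuousAt.comp (f := fun x : ℝ ↦ (x : ℂ)) (g := koebe)
          ((differentiableOn_koebe.differentiableAt
            (Metric.ball_mem_nhds _ one_pos)).continuousAt) (by fun_prop)
      simpa [hk0] using this.tendsto.mono_left (nhdsWithin_le_nhds (s := Ioi 0))
    · filter_upwards [self_mem_nhdsWithin] with x (hx : 0 < x)
      have h1 : (x : ℂ) ≠ 0 := by exact_mod_cast hx.ne'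
      have h2 : (1 + x : ℂ) ≠ 0 := by exact_mod_cast (by linarith : (1 + x : ℝ) ≠ 0)
      simp [koebe, h1, h2]
  refine hT.frequently (Eventually.frequently ?_)
  filter_upwards [Ioo_mem_nhdsGT one_pos] with x hx
  have hx' : x ∈ Ioo (-1 : ℝ) 1 := ⟨by linarith [hx.1], hx.2⟩
  have hx0 : (x : ℂ) ≠ 0 := by exact_mod_cast hx.1.ne'
  have hx1 : 1 + x ≠ 0 := by linarith [hx.1]
  have hx1' : (1 + x : ℂ) ≠ 0 := by exact_mod_cast hx1
  set y : ℝ := 4 * x / (1 + x) ^ 2 with hy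
  have hky : koebe x = y := by simp [koebe, hy]
  have hy1 : y < 1 := by
    rw [hy, div_lt_one (by positivity)]
    nlinarith [sq_pos_of_pos (show 0 < 1 - x by linarith [hx.2])]
  have h := hσ' x hx'
  rw [dslope_of_ne _ hx0, slope_def_field, Function.comp_apply, Function.comp_apply, hk0, hky,
    sub_zero, Complex.div_ofReal_re, Complex.sub_re] at h
  have hint : ∫ t in Icc (0 : ℝ) 1, (1 - (t : ℂ) * y)⁻¹ ∂σ =
      ((4⁻¹ * (1 + x) ^ 2 * ∫ t, ((1 + x) ^ 2 - 4 * x * (t : ℝ))⁻¹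
        ∂(σ' : Measure (Icc (0 : ℝ) 1)) : ℝ) : ℂ) := by
    rw [hres, hσ, integral_smul_nnreal_measure, integral_map measurable_subtype_coe.aemeasurable
      (Measurable.aestronglyMeasurable (by fun_prop)), mul_assoc, ← integral_const_mul]
    rw [NNReal.smul_def, Complex.real_smul, Complex.ofReal_mul, ← integral_complex_ofReal]
    congr 1
    refine integral_congr_ae (ae_of_all _ fun t ↦ ?_)
    have : (1 + x) ^ 2 - 4 * x * (t : ℝ) = (1 + x) ^ 2 * (1 - t * y) := by
      rw [hy]; field_simp
    beta_reduce
    rw [this, mul_inv, mul_inv_cancel_left₀ (pow_ne_zero 2 hx1)]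
    push_cast; rfl
  have e1 : g y = ((g y).re : ℂ) := Complex.ext rfl (by simpa using him y hy1)
  have e0 : g 0 = ((g 0).re : ℂ) := Complex.ext rfl (by simpa using him 0 one_pos)
  rw [hky, hint, h, e1, e0]
  norm_cast
  have hyx : y * (4⁻¹ * (1 + x) ^ 2) = x := by rw [hy]; field_simp
  rw [← mul_assoc, hyx, mul_div_cancel₀ _ hx.1.ne']
  ring

/-! ### Bounds on imaginary parts and the inverse second moment -/

lemma im_log_one_div_one_sub_mem {t : ℝ} (ht : t ∈ Icc (0 : ℝ) 1) {z : ℂ} (hz : 0 < z.im) :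
    (Complex.log (1 / (1 - (t : ℂ) * z))).im ∈ Icc 0 Real.pi := by
  rw [log_one_div_one_sub ht (offReal_subset_slitAtOne hz.ne'), Complex.neg_im, Complex.log_im]
  have him : (1 - (t : ℂ) * z).im = -(t * z.im) := by simp
  refine ⟨?_, by linarith [Complex.neg_pi_lt_arg (1 - (t : ℂ) * z)]⟩
  rcases ht.1.eq_or_lt with h | h
  · simp [← h]
  · have : (1 - (t : ℂ) * z).im < 0 := by rw [him]; linarith [mul_pos h hz]
    linarith [Complex.arg_neg_iff.2 this]

lemma im_logPotential (μ : Measure ℝ) [IsFiniteMeasure μ] {z : ℂ} (hz : z ∈ slitAtOne) :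
    (logPotential μ z).im =
      ∫ t in Icc (0 : ℝ) 1, (Complex.log (1 / (1 - (t : ℂ) * z))).im ∂μ :=
  (Complex.imCLM.integral_comp_comm
    ((continuousOn_log_one_div_one_sub hz).integrableOn_compact isCompact_Icc)).symm

lemma im_logPotential_mem (μ : Measure ℝ) [IsProbabilityMeasure μ] {z : ℂ} (hz : 0 < z.im) :
    (logPotential μ z).im ∈ Icc 0 Real.pi := by
  have hz' : z ∈ slitAtOne := offReal_subset_slitAtOne hz.ne'
  rw [im_logPotential μ hz']
  constructor
  · exact setIntegral_nonneg measurableSet_Icc fun t ht ↦ (im_log_one_div_one_sub_mem ht hz).1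
  · have h1 : ∫ t in Icc (0 : ℝ) 1, (Complex.log (1 / (1 - (t : ℂ) * z))).im ∂μ ≤
        ∫ _ in Icc (0 : ℝ) 1, Real.pi ∂μ :=
      setIntegral_mono_on ((Complex.continuous_im.comp_continuousOn
        (continuousOn_log_one_div_one_sub hz')).integrableOn_compact isCompact_Icc)
        (integrable_const _).integrableOn measurableSet_Icc
        fun t ht ↦ (im_log_one_div_one_sub_mem ht hz).2
    refine h1.trans ?_
    rw [setIntegral_const, smul_eq_mul]
    exact mul_le_of_le_one_left Real.pi_pos.le measureReal_le_one

/-- A rescaled Cauchy density. At `t = 0` both sides are `⊤`, which later excludes an atom of `σ` at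
`0`. -/
lemma lintegral_inv_sq_add_sq (t : ℝ) (ht : 0 ≤ t) :
    ∫⁻ x : ℝ, ENNReal.ofReal (((1 - t * x) ^ 2 + t ^ 2)⁻¹) =
      ENNReal.ofReal Real.pi * (ENNReal.ofReal (t ^ 2))⁻¹ := by
  rcases ht.eq_or_lt with rfl | ht
  · simp [Real.pi_pos, ENNReal.mul_top]
  have hk (x : ℝ) : ((1 - t * x) ^ 2 + t ^ 2)⁻¹ = (t ^ 2)⁻¹ * (1 + (x - t⁻¹) ^ 2)⁻¹ := by
    rw [← mul_inv]; congr 1; field_simp; ring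
  simp_rw [hk]
  rw [← ofReal_integral_eq_lintegral_ofReal
    ((integrable_inv_one_add_sq.comp_sub_right t⁻¹).const_mul _)
    (ae_of_all _ fun x ↦ by positivity), integral_const_mul,
    integral_sub_right_eq_self (fun x : ℝ ↦ (1 + x ^ 2)⁻¹), integral_univ_inv_one_add_sq,
    mul_comm, ENNReal.ofReal_mul Real.pi_pos.le, ENNReal.ofReal_inv_of_pos (by positivity)]

/-- If a primitive of a Stieltjes function has imaginary part in `[0, π]` on the upper half plane,
then the representing measure has inverse second moment at most one. -/
lemma lintegral_inv_sq_le_one {σ : Measure ℝ} [IsFiniteMeasure σ] {f : ℂ → ℂ} {c : ℂ}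
    (hc : c.im = 0)
    (hf : ∀ z : ℂ, 0 < z.im →
      HasDerivAt f (c + z * ∫ t in Icc (0 : ℝ) 1, (1 - (t : ℂ) * z)⁻¹ ∂σ) z)
    (him : ∀ z : ℂ, 0 < z.im → (f z).im ∈ Icc 0 Real.pi) :
    ∫⁻ t in Icc (0 : ℝ) 1, (ENNReal.ofReal (t ^ 2))⁻¹ ∂σ ≤ 1 := by
  set k : ℝ → ℝ → ℝ := fun t x ↦ ((1 - t * x) ^ 2 + t ^ 2)⁻¹ with hk
  set p : ℝ → ℂ := fun x ↦ x + Complex.I with hp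
  have hpi (x : ℝ) : 0 < (p x).im := by simp [hp]
  have hps (x : ℝ) : p x ∈ slitAtOne := offReal_subset_slitAtOne (hpi x).ne'
  set g : ℂ → ℂ := fun z ↦ c + z * ∫ t in Icc (0 : ℝ) 1, (1 - (t : ℂ) * z)⁻¹ ∂σ with hg
  have hgc : Continuous fun x ↦ (g (p x)).im := by
    have h1 : ContinuousOn g slitAtOne := continuousOn_const.add (continuousOn_id.mul
      (analyticOnNhd_integral_one_sub_mul_inv σ).continuousOn)
    exact Complex.continuous_im.comp (h1.comp_continuous (by fun_prop) hps)
  have hkc (x : ℝ) : ContinuousOn (fun t : ℝ ↦ p x * (1 - (t : ℂ) * p x)⁻¹) (Icc 0 1) :=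
    continuousOn_const.mul
      (ContinuousOn.inv₀ (by fun_prop) fun t ht ↦ one_sub_mul_ne_zero ht (hps x))
  have hki (x t : ℝ) : (p x * (1 - (t : ℂ) * p x)⁻¹).im = k t x := by
    rw [Complex.inv_def, ← mul_assoc, Complex.im_mul_ofReal]
    have h1 : (p x * conj (1 - (t : ℂ) * p x)).im = 1 := by simp [hp]; ring
    have h2 : Complex.normSq (1 - (t : ℂ) * p x) = (1 - t * x) ^ 2 + t ^ 2 := by
      simp [hp, Complex.normSq_apply, pow_two]
    rw [h1, h2, one_mul]
  have hgk (x : ℝ) : (g (p x)).im = ∫ t in Icc (0 : ℝ) 1, k t x ∂σ := by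
    simp only [hg, Complex.add_im, hc, zero_add]
    rw [← integral_const_mul]
    refine (Complex.imCLM.integral_comp_comm
      ((hkc x).integrableOn_compact isCompact_Icc)).symm.trans ?_
    simp [hki]
  have hgl (x : ℝ) : ∫⁻ t in Icc (0 : ℝ) 1, ENNReal.ofReal (k t x) ∂σ =
      ENNReal.ofReal (g (p x)).im := by
    rw [hgk, ofReal_integral_eq_lintegral_ofReal _ (ae_of_all _ fun t ↦ by positivity)]
    have := (Complex.continuous_im.comp_continuousOn (hkc x)).integrableOn_compact
      (μ := σ) isCompact_Icc
    exact this.congr (ae_of_all _ fun t ↦ hki x t)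
  have hg0 (x : ℝ) : 0 ≤ (g (p x)).im := by
    rw [hgk]; exact integral_nonneg fun t ↦ by positivity
  -- Over `[-n, n]` the integral is the increment of `Im f` along `Im z = 1`, and `Im f` takes
  -- values in `[0, π]`.
  have hline : ∫⁻ x : ℝ, ENNReal.ofReal (g (p x)).im ≤ ENNReal.ofReal Real.pi := by
    refine le_of_tendsto' (AECover.lintegral_tendsto_of_countably_generated
      (aecover_Icc (μ := volume) (tendsto_neg_atTop_atBot) (tendsto_id (α := ℝ)))
      (hgc.measurable.ennreal_ofReal.aemeasurable)) fun n ↦ ?_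
    rcases lt_or_ge n 0 with hn | hn
    · rw [Icc_eq_empty (by simp only [id]; linarith)]; simp
    rw [← ofReal_integral_eq_lintegral_ofReal hgc.integrableOn_Icc (ae_of_all _ hg0),
      integral_Icc_eq_integral_Ioc, id, ← intervalIntegral.integral_of_le (by linarith),
      intervalIntegral.integral_eq_sub_of_hasDerivAt (f := fun x ↦ (f (p x)).im) ?_
        (hgc.intervalIntegrable _ _)]
    · exact ENNReal.ofReal_le_ofReal (by
        linarith [(him _ (hpi n)).2, (him _ (hpi (-n))).1])
    · intro x _
      have h1 : HasDerivAt p 1 x := (Complex.ofRealCLM.hasDerivAt (x := x)).add_const Complex.I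
      have h2 := (hf _ (hpi x)).scomp x h1
      have h3 := Complex.imCLM.hasFDerivAt.comp_hasDerivAt x h2
      simpa using! h3
  have hswap : ENNReal.ofReal Real.pi * ∫⁻ t in Icc (0 : ℝ) 1, (ENNReal.ofReal (t ^ 2))⁻¹ ∂σ =
      ∫⁻ x : ℝ, ENNReal.ofReal (g (p x)).im := by
    rw [← lintegral_const_mul _ (by fun_prop)]
    simp_rw [← hgl]
    rw [lintegral_lintegral_swap (by fun_prop)]
    refine setLIntegral_congr_fun measurableSet_Icc fun t ht ↦ ?_
    exact (lintegral_inv_sq_add_sq t ht.1).symm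
  rw [← hswap] at hline
  have hπ : ENNReal.ofReal Real.pi ≠ 0 := by simp [Real.pi_pos]
  calc _ = (ENNReal.ofReal Real.pi)⁻¹ * (ENNReal.ofReal Real.pi *
        ∫⁻ t in Icc (0 : ℝ) 1, (ENNReal.ofReal (t ^ 2))⁻¹ ∂σ) := by
        rw [← mul_assoc, ENNReal.inv_mul_cancel hπ ENNReal.ofReal_ne_top, one_mul]
    _ ≤ (ENNReal.ofReal Real.pi)⁻¹ * ENNReal.ofReal Real.pi := by gcongr
    _ = 1 := ENNReal.inv_mul_cancel hπ ENNReal.ofReal_ne_top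

/-! ### Construction of the probability measure -/

/-- Existence of the representing measure. -/
lemma exists_eqOn_logPotential {F : ℂ → ℂ} (hF : AnalyticOnNhd ℂ F slitAtOne) (hF0 : F 0 = 0)
    (hpick : ∀ z ∈ offReal, 0 ≤ z.im * (deriv F z).im)
    (him : ∀ z : ℂ, 0 < z.im → (F z).im ∈ Icc 0 Real.pi) :
    ∃ μ : Measure ℝ, IsProbabilityMeasure μ ∧ μ.support ⊆ Icc 0 1 ∧
      EqOn F (logPotential μ) slitAtOne := by
  have hd : AnalyticOnNhd ℂ (deriv F) slitAtOne := hF.deriv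
  obtain ⟨σ, hσ, hrep⟩ := exists_measure_stieltjes hd hpick
  have hc : (deriv F 0).im = 0 := by
    have := im_eq_zero_of_im_mul_nonneg hpick (x := 0)
    simpa using this (by simpa using (hd 0 zero_mem_slitAtOne).continuousAt)
  have hle := lintegral_inv_sq_le_one hc (fun z hz ↦ by
    have hz' : z ∈ slitAtOne := offReal_subset_slitAtOne hz.ne'
    rw [← hrep z hz']
    exact (hF z hz').differentiableAt.hasDerivAt) him
  set d : ℝ → ENNReal := fun t ↦ (ENNReal.ofReal (t ^ 2))⁻¹ with hdd
  have hdm : Measurable d := by fun_prop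
  set τ : Measure ℝ := (σ.restrict (Icc 0 1)).withDensity d with hτ
  have hτu : τ univ ≤ 1 := by rw [hτ, withDensity_apply _ MeasurableSet.univ]; simpa using hle
  have hτf : IsFiniteMeasure τ := ⟨hτu.trans_lt ENNReal.one_lt_top⟩
  -- Since `d 0 = ⊤`, this says in particular that `σ` does not charge `0`.
  have hdfin : ∀ᵐ t ∂σ.restrict (Icc 0 1), d t < ⊤ :=
    ae_lt_top hdm (hle.trans_lt ENNReal.one_lt_top).ne
  -- The missing mass goes to `0`, where the kernel `log (1 / (1 - t z))` vanishes.
  set μ : Measure ℝ := τ + (1 - τ univ) • Measure.dirac 0 with hμ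
  have hμp : IsProbabilityMeasure μ := ⟨by simp [hμ, add_tsub_cancel_of_le hτu]⟩
  have hτae : ∀ᵐ t ∂τ, t ∈ Icc (0 : ℝ) 1 :=
    (withDensity_absolutelyContinuous _ _).ae_le (ae_restrict_mem measurableSet_Icc)
  have hμae : ∀ᵐ t ∂μ, t ∈ Icc (0 : ℝ) 1 := by
    rw [hμ, ae_add_measure_iff]
    refine ⟨hτae, Measure.ae_smul_measure ?_ _⟩
    rw [ae_dirac_eq]
    exact (by simp : (0 : ℝ) ∈ Icc (0 : ℝ) 1)
  refine ⟨μ, hμp, Measure.support_subset_of_isClosed isClosed_Icc hμae, ?_⟩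
  have hτr : τ.restrict (Icc 0 1) = τ := Measure.restrict_eq_self_of_ae_mem hτae
  have hcont {z : ℂ} (hz : z ∈ slitAtOne) :
      ContinuousOn (fun t : ℝ ↦ (1 - (t : ℂ) * z)⁻¹) (Icc 0 1) :=
    ContinuousOn.inv₀ (by fun_prop) fun t ht ↦ one_sub_mul_ne_zero ht hz
  have hint (κ : Measure ℝ) [IsFiniteMeasure κ] {z : ℂ} (hz : z ∈ slitAtOne) (n : ℕ) :
      IntegrableOn (fun t : ℝ ↦ (t : ℂ) ^ n * (1 - (t : ℂ) * z)⁻¹) (Icc 0 1) κ :=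
    (ContinuousOn.mul (by fun_prop) (hcont hz)).integrableOn_compact isCompact_Icc
  set A : ℂ := ∫ t in Icc (0 : ℝ) 1, (t : ℂ) ∂τ with hA
  -- Integrates `t / (1 - tz) = t + z t² / (1 - tz)`, with `t² τ = σ` on `[0, 1]`.
  have hderiv {z : ℂ} (hz : z ∈ slitAtOne) :
      ∫ t in Icc (0 : ℝ) 1, (t : ℂ) * (1 - (t : ℂ) * z)⁻¹ ∂μ =
        A + z * ∫ t in Icc (0 : ℝ) 1, (1 - (t : ℂ) * z)⁻¹ ∂σ := by
    have h1 : ∫ t in Icc (0 : ℝ) 1, (t : ℂ) * (1 - (t : ℂ) * z)⁻¹ ∂μ =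
        ∫ t in Icc (0 : ℝ) 1, (t : ℂ) * (1 - (t : ℂ) * z)⁻¹ ∂τ := by
      have hi := hint μ hz 1
      simp only [pow_one] at hi
      rw [IntegrableOn, hμ, Measure.restrict_add] at hi
      rw [hμ, Measure.restrict_add]
      rw [integral_add_measure hi.left_of_add_measure hi.right_of_add_measure,
        Measure.restrict_smul, integral_smul_measure]
      simp [restrict_dirac]
    have h2 : ∫ t in Icc (0 : ℝ) 1, (t : ℂ) ^ 2 * (1 - (t : ℂ) * z)⁻¹ ∂τ =
        ∫ t in Icc (0 : ℝ) 1, (1 - (t : ℂ) * z)⁻¹ ∂σ := by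
      rw [hτr, hτ, integral_withDensity_eq_integral_toReal_smul hdm hdfin]
      refine integral_congr_ae ?_
      filter_upwards [hdfin] with t ht
      have ht0 : t ≠ 0 := by rintro rfl; simp [hdd] at ht
      have ht0' : (t : ℂ) ≠ 0 := by exact_mod_cast ht0
      have hdt : (d t).toReal = (t ^ 2)⁻¹ := by
        rw [hdd, ENNReal.toReal_inv, ENNReal.toReal_ofReal (sq_nonneg t)]
      rw [hdt, Complex.real_smul, ← mul_assoc]
      push_cast
      rw [inv_mul_cancel₀ (pow_ne_zero 2 ht0'), one_mul]
    have hti : IntegrableOn (fun t : ℝ ↦ (t : ℂ)) (Icc 0 1) τ :=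
      (Continuous.continuousOn (by fun_prop)).integrableOn_compact isCompact_Icc
    rw [h1, ← h2, hA, ← integral_const_mul, ← integral_add hti ((hint τ hz 2).const_mul z)]
    refine setIntegral_congr_fun measurableSet_Icc fun t ht ↦ ?_
    have := one_sub_mul_ne_zero ht hz
    field_simp
    ring
  have hlin : EqOn (fun z ↦ F z - logPotential μ z) (fun z ↦ (deriv F 0 - A) * z) slitAtOne := by
    have hdz {z : ℂ} (hz : z ∈ slitAtOne) :
        HasDerivAt (fun z ↦ F z - logPotential μ z) (deriv F 0 - A) z := by
      have := (hF z hz).differentiableAt.hasDerivAt.sub (hasDerivAt_logPotential μ hz)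
      rw [hderiv hz, hrep z hz] at this
      convert! this using 1
      ring
    refine isOpen_slitAtOne.eqOn_of_deriv_eq isPreconnected_slitAtOne
      (fun z hz ↦ (hdz hz).differentiableAt.differentiableWithinAt) (by fun_prop)
      (fun z hz ↦ ?_) zero_mem_slitAtOne (by simp [hF0, logPotential_zero])
    rw [(hdz hz).deriv]
    simp
  have hAim : A.im = 0 := by
    rw [hA, integral_complex_ofReal, Complex.ofReal_im]
  -- On the imaginary axis the linear difference has imaginary part `(deriv F 0 - A).re * y`, a
  -- difference of two numbers in `[0, π]`; letting `y` grow kills the real part of the slope.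
  have hbd (y : ℝ) (hy : 0 < y) : |(deriv F 0 - A).re * y| ≤ Real.pi := by
    have hyi : 0 < (y * Complex.I : ℂ).im := by simpa
    have h := congrArg Complex.im (hlin (offReal_subset_slitAtOne hyi.ne'))
    have hr : ((deriv F 0 - A) * (y * Complex.I)).im = (deriv F 0 - A).re * y := by
      simp [Complex.mul_im]
    have h1 := him _ hyi
    have h2 := im_logPotential_mem μ hyi
    beta_reduce at h
    rw [hr, Complex.sub_im] at h
    rw [← h, abs_le]
    constructor <;> linarith [h1.1, h1.2, h2.1, h2.2]
  have hzero : deriv F 0 - A = 0 := by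
    apply Complex.ext
    · by_contra hne
      have hpos : 0 < |(deriv F 0 - A).re| := abs_pos.2 hne
      have hy : 0 < (Real.pi + 1) / |(deriv F 0 - A).re| := div_pos (by positivity) hpos
      have := hbd _ hy
      rw [abs_mul, abs_of_pos hy, mul_div_cancel₀ _ hpos.ne'] at this
      linarith
    · simp [hc, hAim]
  intro z hz
  have := hlin hz
  simp only [hzero, zero_mul] at this
  exact sub_eq_zero.1 this

/-! ### From the representation to the function classes -/

lemma conj_mem_slitAtOne {z : ℂ} (hz : z ∈ slitAtOne) : conj z ∈ slitAtOne := by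
  rw [mem_slitAtOne] at *; simpa using hz

lemma logPotential_conj (μ : Measure ℝ) {z : ℂ} (hz : z ∈ slitAtOne) :
    logPotential μ (conj z) = conj (logPotential μ z) := by
  rw [logPotential, logPotential, ← integral_conj]
  refine setIntegral_congr_fun measurableSet_Icc fun t ht ↦ ?_
  rw [log_one_div_one_sub ht (conj_mem_slitAtOne hz), log_one_div_one_sub ht hz, map_neg,
    ← Complex.log_conj _ (Complex.slitPlane_arg_ne_pi (one_sub_mul_mem_slitPlane ht hz))]
  simp

lemma HasLogRepresentation.eqOn_offReal {f : ℂ → ℂ} (hf : ReflectionSymmetric f) {μ : Measure ℝ}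
    (h : HasLogRepresentation f μ) : EqOn f (logPotential μ) offReal := by
  intro z hz
  rcases lt_or_gt_of_ne hz with hz' | hz'
  · have hc : 0 < (conj z).im := by simpa
    rw [hf z hz', h _ hc]
    change conj (logPotential μ (conj z)) = _
    rw [logPotential_conj μ (offReal_subset_slitAtOne hz), Complex.conj_conj]
  · exact h z hz'

lemma im_deriv_logPotential (μ : Measure ℝ) [IsFiniteMeasure μ] {z : ℂ} (hz : z ∈ slitAtOne) :
    0 ≤ (deriv (logPotential μ) z).im / z.im := by
  rw [(hasDerivAt_logPotential μ hz).deriv]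
  have hi : IntegrableOn (fun t : ℝ ↦ (t : ℂ) * (1 - (t : ℂ) * z)⁻¹) (Icc 0 1) μ :=
    (ContinuousOn.mul (by fun_prop) (ContinuousOn.inv₀ (by fun_prop)
      fun t ht ↦ one_sub_mul_ne_zero ht hz)).integrableOn_compact isCompact_Icc
  have := Complex.imCLM.integral_comp_comm hi
  simp only [Complex.imCLM_apply] at this
  rw [← this, ← integral_div]
  refine integral_nonneg fun t ↦ ?_
  have h : ((t : ℂ) * (1 - (t : ℂ) * z)⁻¹).im =
      t ^ 2 * (Complex.normSq (1 - (t : ℂ) * z))⁻¹ * z.im := by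
    rw [Complex.inv_def, ← mul_assoc, Complex.im_mul_ofReal]
    simp
    ring
  simp only [h, Pi.zero_apply]
  rw [mul_div_assoc]
  exact mul_nonneg (mul_nonneg (sq_nonneg t) (inv_nonneg.2 (Complex.normSq_nonneg _)))
    (by rcases eq_or_ne z.im 0 with h0 | h0 <;> simp [h0])

lemma ReflectionSymmetric.deriv {f : ℂ → ℂ} (hf : ReflectionSymmetric f)
    (hd : DifferentiableOn ℂ f offReal) : ReflectionSymmetric (deriv f) := by
  intro z hz
  have hc : 0 < (conj z).im := by simpa
  have h1 := ((hd.differentiableAt (isOpen_offReal.mem_nhds hc.ne')).hasDerivAt).conj_conj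
  rw [Complex.conj_conj] at h1
  refine (h1.congr_of_eventuallyEq ?_).deriv
  filter_upwards [(isOpen_lt Complex.continuous_im continuous_const).mem_nhds hz] with w hw
  exact hf w hw

lemma HasLogRepresentation.mem_primPick {f : ℂ → ℂ} (hf : ReflectionSymmetric f) {μ : Measure ℝ}
    [IsFiniteMeasure μ] (h : HasLogRepresentation f μ) : f ∈ PrimPick := by
  have heq := h.eqOn_offReal hf
  have hL : AnalyticOnNhd ℂ (logPotential μ) offReal :=
    (analyticOnNhd_logPotential μ).mono offReal_subset_slitAtOne
  have hfd : DifferentiableOn ℂ f offReal := hL.differentiableOn.congr heq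
  refine ⟨hfd, ⟨hfd.deriv isOpen_offReal, fun z hz ↦ ?_, hf.deriv hfd⟩, ?_⟩
  · have := (heq.eventuallyEq_of_mem (isOpen_offReal.mem_nhds hz)).deriv_eq
    rw [this]
    exact im_deriv_logPotential μ (offReal_subset_slitAtOne hz)
  · rw [hf _ (by simp)]
    simp

/-- The Pick function is `exp f`: `0 ≤ Im f ≤ π` makes `sin (Im f)` nonnegative and keeps `f` in the
range of the principal logarithm. -/
lemma HasLogRepresentation.mem_logPick {f : ℂ → ℂ} (hf : ReflectionSymmetric f) {μ : Measure ℝ}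
    [IsProbabilityMeasure μ] (h : HasLogRepresentation f μ) : f ∈ LogPick := by
  have hfd : DifferentiableOn ℂ f offReal := (h.mem_primPick hf).1
  have him (z : ℂ) (hz : 0 < z.im) : (f z).im ∈ Icc 0 Real.pi := by
    rw [h z hz]; exact im_logPotential_mem μ hz
  refine ⟨hf, fun z ↦ Complex.exp (f z), ⟨hfd.cexp, fun z hz ↦ ?_, fun z hz ↦ ?_⟩,
    ⟨Complex.I, by simp [offReal], Complex.exp_ne_zero _⟩, fun z hz ↦ ?_⟩
  · rcases lt_or_gt_of_ne hz with hz' | hz'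
    · have hc : 0 < (conj z).im := by simpa
      refine div_nonneg_of_nonpos ?_ hz'.le
      beta_reduce
      rw [hf z hz', Complex.exp_im, Complex.conj_im, Real.sin_neg]
      have := Real.sin_nonneg_of_mem_Icc (him _ hc)
      exact mul_nonpos_of_nonneg_of_nonpos (Real.exp_pos _).le (by linarith)
    · rw [Complex.exp_im]
      exact div_nonneg (mul_nonneg (Real.exp_pos _).le
        (Real.sin_nonneg_of_mem_Icc (him z hz'))) hz'.le
  · beta_reduce
    rw [hf z hz, Complex.exp_conj]
  · exact (Complex.log_exp (by linarith [(him z hz).1, Real.pi_pos]) (him z hz).2).symm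

/-- `Im log Φ` is the argument of a point in the closed upper half plane; a zero of `Φ` does no
harm, as `arg 0 = 0`. -/
lemma LogPick.im_mem_Icc {f : ℂ → ℂ} (hf : f ∈ LogPick) {z : ℂ} (hz : 0 < z.im) :
    (f z).im ∈ Icc 0 Real.pi := by
  obtain ⟨-, Φ, ⟨-, hΦ, -⟩, -, h⟩ := hf
  rw [h z hz, Complex.log_im]
  refine ⟨Complex.arg_nonneg_iff.2 ?_, Complex.arg_le_pi _⟩
  have := hΦ z hz.ne'
  simpa [div_mul_cancel₀ _ hz.ne'] using mul_nonneg this hz.le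

/-! ### Constant potentials and the main theorem -/

/-- A constant logarithmic potential vanishes, and its measure is the point mass at zero. -/
lemma ae_eq_zero_of_logPotential_const {μ : Measure ℝ} [IsFiniteMeasure μ]
    (hμ : ∀ᵐ t ∂μ, t ∈ Icc (0 : ℝ) 1) {c : ℂ} (hc : ∀ z : ℂ, 0 < z.im → logPotential μ z = c) :
    c = 0 ∧ ∀ᵐ t ∂μ, t = 0 := by
  have hc0 : c = 0 := by
    have hcont := (analyticOnNhd_logPotential μ 0 zero_mem_slitAtOne).continuousAt
    have h1 : ContinuousAt (fun y : ℝ ↦ logPotential μ (y * Complex.I)) 0 :=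
      ContinuousAt.comp (f := fun y : ℝ ↦ (y * Complex.I : ℂ)) (g := logPotential μ) (by simpa using hcont)
        (by fun_prop)
    have h2 := h1.tendsto.mono_left (nhdsWithin_le_nhds (s := Ioi 0))
    simp only [Complex.ofReal_zero, zero_mul, logPotential_zero] at h2
    refine tendsto_nhds_unique (tendsto_const_nhds.congr' ?_) h2
    filter_upwards [self_mem_nhdsWithin] with y (hy : 0 < y)
    exact (hc _ (by simpa)).symm
  refine ⟨hc0, ?_⟩
  have hI : 0 < Complex.I.im := by simp
  have hIs : Complex.I ∈ slitAtOne := offReal_subset_slitAtOne hI.ne'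
  have h0 := im_logPotential μ hIs
  -- The nonnegative integrand at `z = i` is `-arg (1 - t i)`, which vanishes only for `t = 0`.
  rw [hc _ hI, hc0, Complex.zero_im, eq_comm, setIntegral_eq_zero_iff_of_nonneg_ae] at h0
  · rw [Measure.restrict_eq_self_of_ae_mem hμ] at h0
    filter_upwards [h0, hμ] with t ht htm
    rw [log_one_div_one_sub htm hIs, Pi.zero_apply, Complex.neg_im, Complex.log_im, neg_eq_zero,
      Complex.arg_eq_zero_iff] at ht
    simpa using ht.2
  · filter_upwards [ae_restrict_mem measurableSet_Icc] with t ht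
    exact (im_log_one_div_one_sub_mem ht hI).1
  · exact (Complex.continuous_im.comp_continuousOn
      (continuousOn_log_one_div_one_sub hIs)).integrableOn_compact isCompact_Icc

theorem corollary2 (f : ℂ → ℂ) (hf : ReflectionSymmetric f) :
    ((f ∈ PrimPick ∩ LogPick ∧ ∃ F : ℂ → ℂ, IsHolExtension f (Set.Iio 1) F ∧ F 0 = 0) ↔
      ∃ μ : MeasureTheory.Measure ℝ, MeasureTheory.IsProbabilityMeasure μ ∧
        μ.support ⊆ Set.Icc 0 1 ∧ HasLogRepresentation f μ) ∧
    ∀ μ : MeasureTheory.Measure ℝ, MeasureTheory.IsProbabilityMeasure μ →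
      μ.support ⊆ Set.Icc 0 1 → HasLogRepresentation f μ →
      (∃ c : ℂ, ∀ z : ℂ, 0 < z.im → f z = c) →
        (∀ z ∈ offReal, f z = 0) ∧ μ.support = {0} ∧ μ {0} = 1 := by
  refine ⟨⟨?_, ?_⟩, ?_⟩
  · rintro ⟨⟨hprim, hlog⟩, F, ⟨hFa, hFf⟩, hF0⟩
    obtain ⟨μ, hμ, hsupp, heq⟩ := exists_eqOn_logPotential (F := F) hFa hF0
      (fun z hz ↦ by
        rw [(hFf.eventuallyEq_of_mem (isOpen_offReal.mem_nhds hz)).deriv_eq]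
        have h := mul_nonneg (hprim.2.1.2.1 z hz) (mul_self_nonneg z.im)
        rwa [← mul_assoc, div_mul_cancel₀ _ hz, mul_comm] at h)
      (fun z hz ↦ by rw [hFf hz.ne']; exact LogPick.im_mem_Icc hlog hz)
    exact ⟨μ, hμ, hsupp, fun z hz ↦
      (hFf hz.ne').symm.trans (heq (offReal_subset_slitAtOne hz.ne'))⟩
  · rintro ⟨μ, hμ, -, h⟩
    exact ⟨⟨h.mem_primPick hf, h.mem_logPick hf⟩, logPotential μ,
      ⟨analyticOnNhd_logPotential μ, (h.eqOn_offReal hf).symm⟩, logPotential_zero μ⟩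
  · rintro μ hμ hsupp h ⟨c, hc⟩
    have hae : ∀ᵐ t ∂μ, t ∈ Icc (0 : ℝ) 1 := mem_of_superset Measure.support_mem_ae hsupp
    obtain ⟨rfl, h0⟩ := ae_eq_zero_of_logPotential_const hae (c := c)
      fun z hz ↦ (h z hz).symm.trans (hc z hz)
    refine ⟨fun z hz ↦ ?_, ?_, ?_⟩
    · rcases lt_or_gt_of_ne hz with hz' | hz'
      · rw [hf z hz', hc _ (by simpa), map_zero]
      · exact hc z hz'
    · have hs : μ.support ⊆ {0} := Measure.support_subset_of_isClosed isClosed_singleton h0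
      exact (subset_singleton_iff_eq.1 hs).resolve_left
        (Measure.nonempty_support (IsProbabilityMeasure.ne_zero μ)).ne_empty
    · exact (prob_compl_eq_zero_iff (measurableSet_singleton 0)).1 h0
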